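/- Boolean algebras are not assumed to be unital. Let $\mathcal L$ be a set and let $\theta=(\theta_\alpha)_{\alpha\in\mathcal L}$ be a family of Boolean homomorphisms $\mathcal B\to\mathcal B$ with $\theta_\alpha(\emptyset)=\emptyset$. For $A\in\mathcal B$ put $\Delta_A=\{\alpha:\theta_\alpha(A)\neq\emptyset\}$, and let $\mathcal B_{reg}$ be the ideal of those $A$ such that $0<|\Delta_C|<\infty$ for every $\emptyset\ne C\subseteq A$. A relative generalized Boolean dynamical system $(\mathcal B,\mathcal L,\theta,\mathcal I_\alpha;\mathcal J)$ consists of such data, of ideals $\mathcal I_\alpha$ of $\mathcal B$ with $\{A: A\subseteq\theta_\alpha(C)\text{ for some }C\in\mathcal B\}\subseteq\mathcal I_\alpha$ for each $\alpha\in\mathcal L$, and of an ideal $\mathcal J$ of $\mathcal B_{reg}$. A $(\mathcal B,\mathcal L,\theta,\mathcal I_\alpha;\mathcal J)$-representation in a $C^*$-algebra is a family of projections $P_A$ ($A\in\mathcal B$) and partial isometries $S_{\alpha,C}$ ($\alpha\in\mathcal L$, $C\in\mathcal I_\alpha$) such that (i) $P_\emptyset=0$, $P_{A\cap A'}=P_AP_{A'}$,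 $P_{A\cup A'}=P_A+P_{A'}-P_{A\cap A'}$; (ii) $P_AS_{\alpha,C}=S_{\alpha,C}P_{\theta_\alpha(A)}$; (iii) $S_{\alpha,C}^*S_{\alpha',C'}=\delta_{\alpha,\alpha'}P_{C\cap C'}$; (iv) $P_A=\sum_{\alpha\in\Delta_A}S_{\alpha,\theta_\alpha(A)}S_{\alpha,\theta_\alpha(A)}^*$ for $A\in\mathcal J$. The $C^*$-algebra generated by the universal such representation $(p_A,s_{\alpha,C})$ is $C^*(\mathcal B,\mathcal L,\theta,\mathcal I_\alpha;\mathcal J)$, and one writes $C^*(\mathcal B,\mathcal L,\theta,\mathcal I_\alpha)$ if $\mathcal J=\mathcal B_{reg}$. These definitions make sense, and are used, whenever $\mathcal I_\alpha$ is merely a subset of $\mathcal B$ that contains $\theta_\alpha(\mathcal B)$. For an ideal $\mathcal H$ of $\mathcal B$ let $[A]_{\mathcal H}=[C]_{\mathcal H}$ mean that $A\cup A'=C\cup C'$ for some $A',C'\in\mathcal H$. Given a relative generalized Boolean dynamical system $(\mathcal B,\mathcal L,\theta,\mathcal I_\alpha;\mathcal J)$, let $$\widetilde{\mathcal B}=\{(A,[C]_{\mathcal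 J}):A,C\in\mathcal B,\ [A]_{\mathcal B_{reg}}=[C]_{\mathcal B_{reg}}\}$$ with the coordinatewise operations, $\widetilde\theta_\alpha(A,[C]_{\mathcal J})=(\theta_\alpha(A),[\theta_\alpha(A)]_{\mathcal J})$ and $\widetilde{\mathcal I}_\alpha=\{(A,[A]_{\mathcal J}):A\in\mathcal I_\alpha\}$. **Proposition.** For every relative generalized Boolean dynamical system $(\mathcal B,\mathcal L,\theta,\mathcal I_\alpha;\mathcal J)$ there is a $*$-isomorphism $$C^*(\mathcal B,\mathcal L,\theta,\mathcal I_\alpha;\mathcal J)\cong C^*(\widetilde{\mathcal B},\mathcal L,\widetilde\theta,\widetilde{\mathcal I}_\alpha)$$ with $p_A\mapsto p_{(A,[A]_{\mathcal J})}$ for $A\in\mathcal B$ and $s_{\alpha,A}\mapsto s_{\alpha,(A,[A]_{\mathcal J})}$ for $\alpha\in\mathcal L$, $A\in\mathcal I_\alpha$. Moreover, the same holds with $\widetilde{\mathcal I}_\alpha$ replaced by the ideal $\{X\in\widetilde{\mathcal B}: X\subseteq Y\text{ for some }Y\in\widetilde{\mathcal I}_\alpha\}$ of $\widetilde{\mathcal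 B}$ that it generates; with these ideals $(\widetilde{\mathcal B},\mathcal L,\widetilde\theta)$ is a generalized Boolean dynamical system. Hence the $C^*$-algebra of every relative generalized Boolean dynamical system is isomorphic to that of a generalized Boolean dynamical system. -/

import Mathlib

open scoped ENNReal

universe u v w

/-! ## Quotients of Boolean algebras

A Boolean algebra that need not have a unit is a `GeneralizedBooleanAlgebra`; an ideal (a nonempty
subset closed under `⊔` and under `⊓` with arbitrary elements) is an `Order.Ideal`. -/

section Quotient

variable {B : Type u} [GeneralizedBooleanAlgebra B]

/-- `A ∼ A'` modulo the ideal `H` if `A ∪ C = A' ∪ C'` for some `C, C' ∈ H`. -/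
def IdealRel (H : Order.Ideal B) (A A' : B) : Prop :=
  ∃ C ∈ H, ∃ C' ∈ H, A ⊔ C = A' ⊔ C'

theorem idealRel_iff {H : Order.Ideal B} {A A' : B} :
    IdealRel H A A' ↔ ∃ C ∈ H, A ⊔ C = A' ⊔ C := by
  constructor
  · rintro ⟨C, hC, C', hC', h⟩
    refine ⟨C ⊔ C', Order.Ideal.sup_mem hC hC', ?_⟩
    calc A ⊔ (C ⊔ C') = (A ⊔ C) ⊔ C' := (sup_assoc _ _ _).symm
      _ = (A ⊔ C) ⊔ (A' ⊔ C') := by rw [h]; simp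
      _ = A' ⊔ (C ⊔ C') := by
        rw [← h, sup_idem]
        have : A' ⊔ C' ⊔ C = A ⊔ C := by rw [← h]; simp
        rw [sup_comm C, ← sup_assoc, this]
  · rintro ⟨C, hC, h⟩
    exact ⟨C, hC, C, hC, h⟩

/-- Equivalence modulo an ideal. -/
def idealSetoid (H : Order.Ideal B) : Setoid B where
  r := IdealRel H
  iseqv :=
    { refl := fun A => ⟨⊥, H.bot_mem, ⊥, H.bot_mem, rfl⟩
      symm := fun ⟨C, hC, C', hC', h⟩ => ⟨C', hC', C, hC, h.symm⟩
      trans := by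
        intro X Y Z h₁ h₂
        obtain ⟨C, hC, h⟩ := idealRel_iff.1 h₁
        obtain ⟨C', hC', h'⟩ := idealRel_iff.1 h₂
        refine idealRel_iff.2 ⟨C ⊔ C', Order.Ideal.sup_mem hC hC', ?_⟩
        rw [← sup_assoc, h, sup_right_comm, h', sup_right_comm, ← sup_assoc] }

theorem idealRel_sup {H : Order.Ideal B} {A A' D D' : B} (h : IdealRel H A A')
    (h' : IdealRel H D D') : IdealRel H (A ⊔ D) (A' ⊔ D') := by
  obtain ⟨C, hC, h⟩ := h
  obtain ⟨E, hE, C', hC', h⟩ : ∃ E ∈ H, ∃ C' ∈ H, A ⊔ E = A' ⊔ C' := ⟨C, hC, h⟩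
  obtain ⟨F, hF, F', hF', h'⟩ := h'
  refine ⟨E ⊔ F, Order.Ideal.sup_mem hE hF, C' ⊔ F', Order.Ideal.sup_mem hC' hF', ?_⟩
  rw [sup_sup_sup_comm, h, h', sup_sup_sup_comm]

theorem idealRel_inf {H : Order.Ideal B} {A A' D D' : B} (h : IdealRel H A A')
    (h' : IdealRel H D D') : IdealRel H (A ⊓ D) (A' ⊓ D') := by
  obtain ⟨C, hC, h⟩ := idealRel_iff.1 h
  obtain ⟨F, hF, h'⟩ := idealRel_iff.1 h'
  refine idealRel_iff.2 ⟨C ⊔ F, Order.Ideal.sup_mem hC hF, ?_⟩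
  have h1 : A ⊔ (C ⊔ F) = A' ⊔ (C ⊔ F) := by rw [← sup_assoc, h, sup_assoc]
  have h2 : D ⊔ (C ⊔ F) = D' ⊔ (C ⊔ F) := by
    rw [sup_comm C F, ← sup_assoc, h', sup_assoc]
  rw [sup_inf_right, sup_inf_right, h1, h2]

theorem idealRel_sdiff {H : Order.Ideal B} {A A' D D' : B} (h : IdealRel H A A')
    (h' : IdealRel H D D') : IdealRel H (A \ D) (A' \ D') := by
  obtain ⟨C, hC, h⟩ := idealRel_iff.1 h
  obtain ⟨F, hF, h'⟩ := idealRel_iff.1 h'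
  refine idealRel_iff.2 ⟨C ⊔ F, Order.Ideal.sup_mem hC hF, ?_⟩
  have key : ∀ X Y K : B, X \ Y ⊔ K = (X ⊔ K) \ (Y ⊔ K) ⊔ K := by
    intro X Y K
    rw [sup_sdiff, sdiff_eq_bot_iff.2 (le_sup_right : K ≤ Y ⊔ K), sup_bot_eq, ← sdiff_sdiff,
      sdiff_sup_self]
  rw [key A D, key A' D']
  have h1 : A ⊔ (C ⊔ F) = A' ⊔ (C ⊔ F) := by rw [← sup_assoc, h, sup_assoc]
  have h2 : D ⊔ (C ⊔ F) = D' ⊔ (C ⊔ F) := by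
    rw [sup_comm C F, ← sup_assoc, h', sup_assoc]
  rw [h1, h2]

/-- The quotient `B / H`. -/
def IdealQuotient (H : Order.Ideal B) : Type u := Quotient (idealSetoid H)

/-- The class `[A]_H`. -/
def IdealQuotient.mk (H : Order.Ideal B) (A : B) : IdealQuotient H :=
  Quotient.mk (idealSetoid H) A

namespace IdealQuotient

variable {H : Order.Ideal B}

instance : Max (IdealQuotient H) :=
  ⟨Quotient.map₂ (· ⊔ ·) fun _ _ h _ _ h' => idealRel_sup h h'⟩

instance : Min (IdealQuotient H) :=
  ⟨Quotient.map₂ (· ⊓ ·) fun _ _ h _ _ h' => idealRel_inf h h'⟩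

instance : SDiff (IdealQuotient H) :=
  ⟨Quotient.map₂ (· \ ·) fun _ _ h _ _ h' => idealRel_sdiff h h'⟩

instance : Bot (IdealQuotient H) := ⟨mk H ⊥⟩

theorem ind {p : IdealQuotient H → Prop} (h : ∀ A, p (mk H A)) (x : IdealQuotient H) : p x :=
  Quotient.ind h x

theorem mk_sup (A A' : B) : mk H (A ⊔ A') = mk H A ⊔ mk H A' := rfl
theorem mk_inf (A A' : B) : mk H (A ⊓ A') = mk H A ⊓ mk H A' := rfl
theorem mk_sdiff (A A' : B) : mk H (A \ A') = mk H A \ mk H A' := rfl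
theorem mk_bot : mk H ⊥ = ⊥ := rfl

theorem mk_eq_mk {A A' : B} : mk H A = mk H A' ↔ IdealRel H A A' :=
  ⟨fun h => Quotient.exact h, fun h => Quotient.sound h⟩

instance : Lattice (IdealQuotient H) :=
  Lattice.mk'
    (by
      intro x y; induction x using ind; induction y using ind
      simp only [← mk_sup, sup_comm])
    (by
      intro x y z; induction x using ind; induction y using ind; induction z using ind
      simp only [← mk_sup, sup_assoc])
    (by
      intro x y; induction x using ind; induction y using ind
      simp only [← mk_inf, inf_comm])
    (by
      intro x y z; induction x using ind; induction y using ind; induction z using ind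
      simp only [← mk_inf, inf_assoc])
    (by
      intro x y; induction x using ind; induction y using ind
      simp only [← mk_inf, ← mk_sup, sup_inf_self])
    (by
      intro x y; induction x using ind; induction y using ind
      simp only [← mk_inf, ← mk_sup, inf_sup_self])

instance : GeneralizedBooleanAlgebra (IdealQuotient H) where
  le_sup_inf x y z := by
    induction x using ind with | _ A
    induction y using ind with | _ A'
    induction z using ind with | _ C
    exact le_of_eq (congrArg (mk H) (sup_inf_left A A' C).symm)
  sup_inf_sdiff x y := by
    induction x using ind with | _ A
    induction y using ind with | _ A'
    exact congrArg (mk H) (sup_inf_sdiff A A')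
  inf_inf_sdiff x y := by
    induction x using ind with | _ A
    induction y using ind with | _ A'
    exact congrArg (mk H) (inf_inf_sdiff A A')

end IdealQuotient

end Quotient

/-! ## Boolean dynamical systems -/

/-- A Boolean dynamical system: every `θ α` is a Boolean homomorphism with `θ α ∅ = ∅`. -/
structure BooleanDynamicalSystem (B : Type u) (L : Type v) [GeneralizedBooleanAlgebra B] where
  θ : L → B → B
  map_bot : ∀ α, θ α ⊥ = ⊥
  map_sup : ∀ α A A', θ α (A ⊔ A') = θ α A ⊔ θ α A'
  map_inf : ∀ α A A', θ α (A ⊓ A') = θ α A ⊓ θ α A'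
  map_sdiff : ∀ α A A', θ α (A \ A') = θ α A \ θ α A'

namespace BooleanDynamicalSystem

variable {B : Type u} {L : Type v} [GeneralizedBooleanAlgebra B] (T : BooleanDynamicalSystem B L)

/-- `Δ_A`, the set of labels `α` with `θ_α(A) ≠ ∅`. -/
def Δ (A : B) : Set L := {α | T.θ α A ≠ ⊥}

/-- `A` is regular if `0 < |Δ_C| < ∞` for every nonempty `C ⊆ A`. -/
def IsRegular (A : B) : Prop :=
  ∀ C : B, C ≤ A → C ≠ ⊥ → (T.Δ C).Nonempty ∧ (T.Δ C).Finite

/-- `R_α`, the set of all `A` contained in some `θ_α(C)`. -/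
def R (α : L) : Set B := {A | ∃ C, A ≤ T.θ α C}

theorem Δ_bot : T.Δ ⊥ = ∅ := by simp [Δ, T.map_bot]

theorem Δ_sup (A A' : B) : T.Δ (A ⊔ A') = T.Δ A ∪ T.Δ A' := by
  ext α
  simp only [Δ, T.map_sup, Set.mem_ofPred_eq, Set.mem_union, ne_eq, sup_eq_bot_iff]
  tauto

variable {T}

theorem IsRegular.finite_Δ {A : B} (h : T.IsRegular A) : (T.Δ A).Finite := by
  by_cases hA : A = ⊥
  · simp [hA, Δ_bot]
  · exact (h A le_rfl hA).2

theorem IsRegular.mono {A A' : B} (h : T.IsRegular A) (h' : A' ≤ A) : T.IsRegular A' :=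
  fun C hC => h C (hC.trans h')

theorem isRegular_bot : T.IsRegular (⊥ : B) := fun _ hC hC' => absurd (le_bot_iff.1 hC) hC'

theorem IsRegular.sup {A A' : B} (h : T.IsRegular A) (h' : T.IsRegular A') :
    T.IsRegular (A ⊔ A') := by
  intro C hC hC0
  have hdec : C = (C ⊓ A) ⊔ (C ⊓ A') := by rw [← inf_sup_left, inf_eq_left.2 hC]
  have h1 := h.mono (inf_le_right : C ⊓ A ≤ A)
  have h2 := h'.mono (inf_le_right : C ⊓ A' ≤ A')
  rw [hdec, Δ_sup]
  refine ⟨?_, h1.finite_Δ.union h2.finite_Δ⟩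
  by_cases hA : C ⊓ A = ⊥
  · by_cases hA' : C ⊓ A' = ⊥
    · exact absurd (by rw [hdec, hA, hA', sup_bot_eq]) hC0
    · exact (h2 _ le_rfl hA').1.mono Set.subset_union_right
  · exact (h1 _ le_rfl hA).1.mono Set.subset_union_left

variable (T)

/-- The ideal `B_reg` of regular elements. -/
def regIdeal : Order.Ideal B where
  carrier := {A | T.IsRegular A}
  lower' := fun _ _ h hA => IsRegular.mono hA h
  nonempty' := ⟨⊥, isRegular_bot⟩
  directed' := fun A hA A' hA' => ⟨A ⊔ A', IsRegular.sup hA hA', le_sup_left, le_sup_right⟩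

end BooleanDynamicalSystem

/-- A generalized Boolean dynamical system `(B, L, θ, I_α)`. -/
structure GeneralizedBDS (B : Type u) (L : Type v) [GeneralizedBooleanAlgebra B] extends
    BooleanDynamicalSystem B L where
  I : L → Order.Ideal B
  R_subset : ∀ α, toBooleanDynamicalSystem.R α ⊆ I α

/-- A relative generalized Boolean dynamical system `(B, L, θ, I_α; J)`. An ideal of `B_reg` is the
same thing as an ideal of `B` that is contained in `B_reg`. -/
structure RelativeGBDS (B : Type u) (L : Type v) [GeneralizedBooleanAlgebra B] extends
    GeneralizedBDS B L where
  J : Order.Ideal B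
  J_le : J ≤ toBooleanDynamicalSystem.regIdeal

/-- A generalized Boolean dynamical system as a relative one, with `J = B_reg`. -/
def GeneralizedBDS.toRelative {B : Type u} {L : Type v} [GeneralizedBooleanAlgebra B]
    (T : GeneralizedBDS B L) : RelativeGBDS B L where
  toGeneralizedBDS := T
  J := T.regIdeal
  J_le := le_rfl

/-! ## Representations and the universal C*-algebra -/

/-- The data that is needed in order to write down the defining relations of a representation:
a Boolean dynamical system, subsets `I α` (not necessarily ideals) containing the range of `θ α`,
and an ideal of regular elements. -/
structure RelationData (B : Type u) (L : Type v) [GeneralizedBooleanAlgebra B] extends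
    BooleanDynamicalSystem B L where
  I : L → Set B
  θ_mem : ∀ α A, θ α A ∈ I α
  J : Order.Ideal B
  J_le : J ≤ toBooleanDynamicalSystem.regIdeal

/-- A relative generalized Boolean dynamical system is a special case. -/
def RelativeGBDS.toRelationData {B : Type u} {L : Type v} [GeneralizedBooleanAlgebra B]
    (T : RelativeGBDS B L) : RelationData B L where
  toBooleanDynamicalSystem := T.toBooleanDynamicalSystem
  I α := T.I α
  θ_mem α A := T.R_subset α ⟨A, le_rfl⟩
  J := T.J
  J_le := T.J_le

namespace RelationData

variable {B : Type u} {L : Type v} [GeneralizedBooleanAlgebra B]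

/-- A `(B, L, θ, I_α; J)`-representation in a (not necessarily unital) C*-algebra `M`: a family of
projections `P A` and a family of partial isometries `S α C`, `C ∈ I α`, such that (i)-(iv) hold. -/
structure Representation (D : RelationData B L) (M : Type w) [NonUnitalCStarAlgebra M] where
  P : B → M
  S : (α : L) → D.I α → M
  isStarProjection_P : ∀ A, IsStarProjection (P A)
  isPartialIsometry_S : ∀ α C, S α C * star (S α C) * S α C = S α C
  P_bot : P ⊥ = 0
  P_inf : ∀ A A', P (A ⊓ A') = P A * P A'
  P_sup : ∀ A A', P (A ⊔ A') = P A + P A' - P (A ⊓ A')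
  P_mul_S : ∀ A α C, P A * S α C = S α C * P (D.θ α A)
  star_S_mul_S : ∀ α (C C' : D.I α), star (S α C) * S α C' = P (C.1 ⊓ C'.1)
  star_S_mul_S_of_ne : ∀ α α' (C : D.I α) (C' : D.I α'), α ≠ α' → star (S α C) * S α' C' = 0
  P_eq_sum : ∀ A (hA : A ∈ D.J),
    P A = ∑ α ∈ (D.J_le hA).finite_Δ.toFinset,
      S α ⟨D.θ α A, D.θ_mem α A⟩ * star (S α ⟨D.θ α A, D.θ_mem α A⟩)

variable {D : RelationData B L}

theorem Representation.norm_P_le {M : Type w} [NonUnitalCStarAlgebra M] (ρ : D.Representation M)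
    (A : B) : ‖ρ.P A‖ ≤ 1 := by
  have h : ‖ρ.P A‖ * ‖ρ.P A‖ = ‖ρ.P A‖ := by
    rw [← CStarRing.norm_star_mul_self, (ρ.isStarProjection_P A).isSelfAdjoint.star_eq,
      (ρ.isStarProjection_P A).isIdempotentElem.eq]
  nlinarith [norm_nonneg (ρ.P A)]

theorem Representation.norm_S_le {M : Type w} [NonUnitalCStarAlgebra M] (ρ : D.Representation M)
    (α : L) (C : D.I α) : ‖ρ.S α C‖ ≤ 1 := by
  have h : ‖ρ.S α C‖ * ‖ρ.S α C‖ ≤ 1 := by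
    rw [← CStarRing.norm_star_mul_self, ρ.star_S_mul_S]
    exact ρ.norm_P_le _
  nlinarith [norm_nonneg (ρ.S α C)]

variable (D)

/-- All representations of `D` in C*-algebras that live in the universe of `B` and `L`. Up to
isomorphism every representation is in such a C*-algebra, once the C*-algebra has been cut down to
the one that the representation generates (`Representation.exists_anyRepresentation`). -/
structure AnyRepresentation where
  M : Type (max u v)
  [inst : NonUnitalCStarAlgebra M]
  rep : D.Representation M

attribute [instance] AnyRepresentation.inst

/-- The C*-algebra of all bounded families indexed by the representations of `D`. -/
abbrev BigProduct : Type (max u v + 1) := lp (fun ρ : D.AnyRepresentation => ρ.M) ∞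

/-- The family `(P_A)` over all representations. -/
def bigP (A : B) : D.BigProduct :=
  ⟨fun ρ => ρ.rep.P A, memℓp_infty ⟨1, by rintro _ ⟨ρ, rfl⟩; exact ρ.rep.norm_P_le A⟩⟩

/-- The family `(S_{α,C})` over all representations. -/
def bigS (α : L) (C : D.I α) : D.BigProduct :=
  ⟨fun ρ => ρ.rep.S α C, memℓp_infty ⟨1, by rintro _ ⟨ρ, rfl⟩; exact ρ.rep.norm_S_le α C⟩⟩

/-- The closed star subalgebra generated by the `P_A` and `S_{α,C}`. -/
noncomputable def universalSubalgebra : NonUnitalStarSubalgebra ℂ D.BigProduct :=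
  (NonUnitalStarAlgebra.adjoin ℂ
    (Set.range D.bigP ∪ {x | ∃ α, ∃ C : D.I α, x = D.bigS α C})).topologicalClosure

/-- The universal C*-algebra generated by a representation of `D`. Its universal property, with
respect to all C*-algebras, is `CStar.existsUnique_lift`. -/
def CStar : Type (max u v + 1) := D.universalSubalgebra

noncomputable instance : NonUnitalCStarAlgebra D.CStar :=
  haveI : IsClosed (D.universalSubalgebra : Set D.BigProduct) :=
    NonUnitalStarSubalgebra.isClosed_topologicalClosure _
  inferInstanceAs (NonUnitalCStarAlgebra D.universalSubalgebra)

namespace CStar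

/-- The generator `p_A`. -/
def p (A : B) : D.CStar :=
  ⟨D.bigP A, NonUnitalStarSubalgebra.le_topologicalClosure _
    (NonUnitalStarAlgebra.subset_adjoin ℂ _ (Or.inl ⟨A, rfl⟩))⟩

/-- The generator `s_{α,C}`. -/
def s (α : L) (C : D.I α) : D.CStar :=
  ⟨D.bigS α C, NonUnitalStarSubalgebra.le_topologicalClosure _
    (NonUnitalStarAlgebra.subset_adjoin ℂ _ (Or.inr ⟨α, C, rfl⟩))⟩

end CStar

/-! ### The universal property, for C*-algebras of all universes -/

variable {D}

/-- A C*-algebra whose carrier is small is isomorphic to one in the smaller universe. -/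
theorem exists_bijective_of_small (N : Type w) [NonUnitalCStarAlgebra N] [Small.{u} N] :
    ∃ (K : Type u) (_ : NonUnitalCStarAlgebra K) (f : K →⋆ₙₐ[ℂ] N), Function.Bijective f := by
  let e : Shrink.{u} N ≃ N := (equivShrink N).symm
  let i1 : NonUnitalRing (Shrink.{u} N) := e.nonUnitalRing
  let f : Shrink.{u} N →ₙ+* N := (e.ringEquiv : Shrink.{u} N →ₙ+* N)
  let i3 : NonUnitalNormedRing (Shrink.{u} N) := NonUnitalNormedRing.induced _ N f e.injective
  let i2 : Module ℂ (Shrink.{u} N) := e.module ℂ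
  have hn : ∀ x : Shrink.{u} N, ‖x‖ = ‖e x‖ := fun _ => rfl
  have hm : ∀ x y : Shrink.{u} N, e (x * y) = e x * e y := fun x y => map_mul f x y
  have ha : ∀ x y : Shrink.{u} N, e (x + y) = e x + e y := fun x y => map_add f x y
  have hsm : ∀ (c : ℂ) (x : Shrink.{u} N), e (c • x) = c • e x :=
    fun c x => map_smul (e.linearEquiv ℂ) c x
  let i4 : NormedSpace ℂ (Shrink.{u} N) :=
    { i2 with norm_smul_le := fun c x => by
                change ‖e (c • x)‖ ≤ ‖c‖ * ‖e x‖
                rw [hsm]; exact norm_smul_le c (e x) }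
  let i5 : StarRing (Shrink.{u} N) :=
    { star := fun x => e.symm (star (e x))
      star_involutive := fun x => by simp
      star_mul := fun x y => e.injective (by simp only [hm, Equiv.apply_symm_apply, star_mul])
      star_add := fun x y => e.injective (by simp only [ha, Equiv.apply_symm_apply, star_add]) }
  have hs : ∀ x : Shrink.{u} N, e (star x) = star (e x) := fun x => e.apply_symm_apply _
  have hc : CompleteSpace (Shrink.{u} N) := by
    have hiso : Isometry f := AddMonoidHomClass.isometry_of_norm f fun x => rfl
    rw [completeSpace_iff_isComplete_range hiso.isUniformInducing,
      Set.range_eq_univ.2 (show Function.Surjective f from e.surjective)]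
    exact isComplete_univ
  have hcs : CStarRing (Shrink.{u} N) :=
    ⟨fun x => by rw [hn, hn, hm, hs, CStarRing.norm_star_mul_self]⟩
  have i6 : StarModule ℂ (Shrink.{u} N) :=
    ⟨fun c x => e.injective (by rw [hs, hsm, hsm, hs, star_smul])⟩
  have i7 : IsScalarTower ℂ (Shrink.{u} N) (Shrink.{u} N) :=
    ⟨fun c x y => e.injective (by
      simp only [smul_eq_mul, hm, hsm, smul_mul_assoc])⟩
  have i8 : SMulCommClass ℂ (Shrink.{u} N) (Shrink.{u} N) :=
    ⟨fun c x y => e.injective (by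
      simp only [smul_eq_mul, hm, hsm, mul_smul_comm])⟩
  refine ⟨Shrink.{u} N, { i3, i5, i4, hc, hcs, i6, i7, i8 with }, ?_, ?_⟩
  · exact { toFun := e, map_smul' := hsm, map_zero' := map_zero f, map_add' := map_add f,
            map_mul' := hm, map_star' := hs }
  · exact e.bijective

/-- The closed star subalgebra generated by a small set is small. -/
theorem small_topologicalClosure_adjoin {M : Type w} [NonUnitalCStarAlgebra M] (t : Set M)
    [Small.{u} t] : Small.{u} (NonUnitalStarAlgebra.adjoin ℂ t).topologicalClosure := by
  have h1 : Small.{u} (t ∪ star t : Set M) := by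
    have : Small.{u} (star t : Set M) := by
      rw [← Set.image_star]; infer_instance
    infer_instance
  have h2 : Small.{u} (Subsemigroup.closure (t ∪ star t)) := by
    let F : FreeSemigroup (t ∪ star t : Set M) →ₙ* M := FreeSemigroup.lift Subtype.val
    have : Small.{u} (FreeSemigroup (t ∪ star t : Set M)) := by
      refine small_of_injective (β := (t ∪ star t : Set M) × List (t ∪ star t : Set M))
        (f := fun x => (x.head, x.tail)) ?_
      rintro ⟨a, b⟩ ⟨c, d⟩ h
      simpa using h
    have hle : Subsemigroup.closure (t ∪ star t) ≤ F.srange := by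
      rw [Subsemigroup.closure_le]
      intro x hx
      exact ⟨FreeSemigroup.of ⟨x, hx⟩, by simp [F]⟩
    have : Small.{u} (Set.range F) := inferInstance
    exact small_subset (t := (Subsemigroup.closure (t ∪ star t) : Set M)) (s := Set.range F) hle
  have h3 : Small.{u} (NonUnitalStarAlgebra.adjoin ℂ t : Set M) := by
    have hsub : ((NonUnitalStarAlgebra.adjoin ℂ t : NonUnitalStarSubalgebra ℂ M) : Set M) ⊆
        Set.range (Finsupp.linearCombination ℂ
          (Subtype.val : Subsemigroup.closure (t ∪ star t) → M)) := by
      intro x hx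
      have hx' : x ∈ Submodule.span ℂ (Subsemigroup.closure (t ∪ star t) : Set M) := by
        rw [← NonUnitalStarAlgebra.adjoin_eq_span]; exact hx
      rwa [Finsupp.mem_span_iff_linearCombination] at hx'
    have : Small.{u} (Subsemigroup.closure (t ∪ star t) →₀ ℂ) :=
      small_of_injective DFunLike.coe_injective
    exact small_subset hsub
  refine small_subset (s := Set.range fun x : ℕ → (NonUnitalStarAlgebra.adjoin ℂ t : Set M) =>
    Filter.limUnder Filter.atTop fun n => (x n : M)) ?_
  intro x hx
  obtain ⟨y, hy, hxy⟩ := mem_closure_iff_seq_limit.1 hx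
  exact ⟨fun n => ⟨y n, hy n⟩, hxy.limUnder_eq⟩

/-- A family is a representation if it becomes one under an injective star homomorphism. -/
def Representation.ofInjective {K : Type*} {M : Type*} [NonUnitalCStarAlgebra K]
    [NonUnitalCStarAlgebra M] (ρ : D.Representation M) (f : K →⋆ₙₐ[ℂ] M)
    (hf : Function.Injective f) (P : B → K) (S : (α : L) → D.I α → K) (hP : ∀ A, f (P A) = ρ.P A)
    (hS : ∀ α C, f (S α C) = ρ.S α C) : D.Representation K where
  P := P
  S := S
  isStarProjection_P A := by
    have h := ρ.isStarProjection_P A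
    refine ⟨hf ?_, hf ?_⟩
    · rw [map_mul, hP, h.isIdempotentElem.eq]
    · rw [map_star, hP, h.isSelfAdjoint.star_eq]
  isPartialIsometry_S α C := hf (by simp only [map_mul, map_star, hS, ρ.isPartialIsometry_S])
  P_bot := hf (by rw [hP, map_zero, ρ.P_bot])
  P_inf A A' := hf (by rw [map_mul, hP, hP, hP, ρ.P_inf])
  P_sup A A' := hf (by rw [map_sub, map_add, hP, hP, hP, hP, ρ.P_sup])
  P_mul_S A α C := hf (by rw [map_mul, map_mul, hP, hP, hS, ρ.P_mul_S])
  star_S_mul_S α C C' := hf (by rw [map_mul, map_star, hP, hS, hS, ρ.star_S_mul_S])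
  star_S_mul_S_of_ne α α' C C' h := hf (by
    rw [map_mul, map_star, hS, hS, ρ.star_S_mul_S_of_ne _ _ _ _ h, map_zero])
  P_eq_sum A hA := hf (by simp only [map_sum, map_mul, map_star, hP, hS]; exact ρ.P_eq_sum A hA)

/-- Every representation factors, through an injective star homomorphism, over a representation in
a C*-algebra in the universe of `B` and `L`. -/
theorem Representation.exists_anyRepresentation {M : Type w} [NonUnitalCStarAlgebra M]
    (ρ : D.Representation M) : ∃ (σ : D.AnyRepresentation) (f : σ.M →⋆ₙₐ[ℂ] M),
      (∀ A, f (σ.rep.P A) = ρ.P A) ∧ ∀ α C, f (σ.rep.S α C) = ρ.S α C := by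
  let t : Set M := Set.range ρ.P ∪ Set.range fun x : (α : L) × D.I α => ρ.S x.1 x.2
  have ht : ∀ x ∈ t, x ∈ (NonUnitalStarAlgebra.adjoin ℂ t).topologicalClosure := fun x hx =>
    NonUnitalStarSubalgebra.le_topologicalClosure _ (NonUnitalStarAlgebra.subset_adjoin ℂ _ hx)
  have : Small.{max u v} t := inferInstance
  have := small_topologicalClosure_adjoin.{max u v} t
  have hcl : IsClosed ((NonUnitalStarAlgebra.adjoin ℂ t).topologicalClosure : Set M) :=
    NonUnitalStarSubalgebra.isClosed_topologicalClosure _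
  obtain ⟨K, iK, f, hf⟩ := exists_bijective_of_small.{max u v}
    (NonUnitalStarAlgebra.adjoin ℂ t).topologicalClosure
  let g : K →⋆ₙₐ[ℂ] M :=
    (NonUnitalStarSubalgebraClass.subtype (NonUnitalStarAlgebra.adjoin ℂ t).topologicalClosure).comp
      f
  have hg : ∀ x ∈ t, ∃ y, g y = x := fun x hx => by
    obtain ⟨y, hy⟩ := hf.2 ⟨x, ht x hx⟩
    exact ⟨y, congrArg Subtype.val hy⟩
  choose P hP using fun A => hg (ρ.P A) (Or.inl ⟨A, rfl⟩)
  choose S hS using fun (α : L) (C : D.I α) => hg (ρ.S α C) (Or.inr ⟨⟨α, C⟩, rfl⟩)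
  have hgi : Function.Injective g := Subtype.val_injective.comp hf.1
  exact ⟨⟨K, ρ.ofInjective g hgi P S hP hS⟩, g, hP, hS⟩

/-- The coordinate of the big product at a representation. -/
def evalHom (σ : D.AnyRepresentation) : D.BigProduct →⋆ₙₐ[ℂ] σ.M where
  toFun x := x σ
  map_smul' _ _ := rfl
  map_zero' := rfl
  map_add' _ _ := rfl
  map_mul' _ _ := rfl
  map_star' _ := rfl

namespace CStar

/-- The elements `p_A` and `s_{α,C}` form a representation. -/
noncomputable def universalRep : D.Representation D.CStar where
  P := p D
  S := s D
  isStarProjection_P A := by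
    refine ⟨Subtype.ext (lp.ext (funext fun σ => ?_)), Subtype.ext (lp.ext (funext fun σ => ?_))⟩
    · exact (σ.rep.isStarProjection_P A).isIdempotentElem
    · exact (σ.rep.isStarProjection_P A).isSelfAdjoint
  isPartialIsometry_S α C :=
    Subtype.ext (lp.ext (funext fun σ => σ.rep.isPartialIsometry_S α C))
  P_bot := Subtype.ext (lp.ext (funext fun σ => σ.rep.P_bot))
  P_inf A A' := Subtype.ext (lp.ext (funext fun σ => σ.rep.P_inf A A'))
  P_sup A A' := Subtype.ext (lp.ext (funext fun σ => σ.rep.P_sup A A'))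
  P_mul_S A α C := Subtype.ext (lp.ext (funext fun σ => σ.rep.P_mul_S A α C))
  star_S_mul_S α C C' := Subtype.ext (lp.ext (funext fun σ => σ.rep.star_S_mul_S α C C'))
  star_S_mul_S_of_ne α α' C C' h :=
    Subtype.ext (lp.ext (funext fun σ => σ.rep.star_S_mul_S_of_ne α α' C C' h))
  P_eq_sum A hA := by
    refine Subtype.ext (lp.ext (funext fun σ => ?_))
    refine (σ.rep.P_eq_sum A hA).trans ?_
    have h := map_sum ((evalHom σ).comp
      (NonUnitalStarSubalgebraClass.subtype D.universalSubalgebra))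
      (fun α => s D α ⟨D.θ α A, D.θ_mem α A⟩ * star (s D α ⟨D.θ α A, D.θ_mem α A⟩))
      (D.J_le hA).finite_Δ.toFinset
    exact h.symm

/-- The universal property: every representation in a C*-algebra of any universe is the image of
the representation `p_A, s_{α,C}` under exactly one star homomorphism. -/
theorem existsUnique_lift {M : Type w} [NonUnitalCStarAlgebra M] (ρ : D.Representation M) :
    ∃! π : D.CStar →⋆ₙₐ[ℂ] M, (∀ A, π (p D A) = ρ.P A) ∧ ∀ α C, π (s D α C) = ρ.S α C := by
  obtain ⟨σ, f, hP, hS⟩ := ρ.exists_anyRepresentation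
  let π : D.CStar →⋆ₙₐ[ℂ] M :=
    f.comp ((evalHom σ).comp (NonUnitalStarSubalgebraClass.subtype D.universalSubalgebra))
  refine ⟨π, ⟨hP, hS⟩, ?_⟩
  rintro π' ⟨hP', hS'⟩
  have hcl : IsClosed (D.universalSubalgebra : Set D.BigProduct) :=
    NonUnitalStarSubalgebra.isClosed_topologicalClosure _
  have hc : ∀ ψ : D.CStar →⋆ₙₐ[ℂ] M, Continuous ψ := fun ψ =>
    AddMonoidHomClass.continuous_of_bound ψ 1 fun x => by
      simpa only [one_mul] using NonUnitalStarAlgHom.norm_apply_le ψ x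
  let ι : D.CStar →⋆ₙₐ[ℂ] D.BigProduct :=
    NonUnitalStarSubalgebraClass.subtype D.universalSubalgebra
  let E : NonUnitalStarSubalgebra ℂ D.CStar := NonUnitalStarAlgHom.equalizer π' π
  have hE : IsClosed (E : Set D.CStar) := isClosed_eq (hc π') (hc π)
  have hle : D.universalSubalgebra ≤ E.map ι := by
    refine NonUnitalStarSubalgebra.topologicalClosure_minimal _ ?_ ?_
    · refine NonUnitalStarAlgebra.adjoin_le ?_
      rintro _ (⟨A, rfl⟩ | ⟨α, C, rfl⟩)
      · exact ⟨p D A, (hP' A).trans (hP A).symm, rfl⟩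
      · exact ⟨s D α C, (hS' α C).trans (hS α C).symm, rfl⟩
    · exact hcl.isClosedEmbedding_subtypeVal.isClosedMap _ hE
  ext x
  obtain ⟨y, hy, hyx⟩ := hle x.2
  have : y = x := Subtype.ext hyx
  exact this ▸ hy

end CStar

end RelationData

/-- `C*(B, L, θ, I_α; J)`. -/
abbrev RelativeGBDS.CStar {B : Type u} {L : Type v} [GeneralizedBooleanAlgebra B]
    (T : RelativeGBDS B L) : Type (max u v + 1) := T.toRelationData.CStar

/-- `C*(B, L, θ, I_α) = C*(B, L, θ, I_α; B_reg)`. -/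
abbrev GeneralizedBDS.CStar {B : Type u} {L : Type v} [GeneralizedBooleanAlgebra B]
    (T : GeneralizedBDS B L) : Type (max u v + 1) := T.toRelative.CStar

/-! ## The system `(B̃, L, θ̃, Ĩ_α)` -/

namespace RelativeGBDS

variable {B : Type u} {L : Type v} [GeneralizedBooleanAlgebra B] (T : RelativeGBDS B L)

/-- `B̃`, the set of pairs `(A, [C]_J)` with `[A] = [C]` modulo `B_reg`. -/
def Tilde : Type u :=
  {X : B × IdealQuotient T.J // ∃ C : B, X.2 = IdealQuotient.mk T.J C ∧
    IdealQuotient.mk T.regIdeal X.1 = IdealQuotient.mk T.regIdeal C}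

namespace Tilde

instance : Max T.Tilde :=
  ⟨fun X Y => ⟨X.1 ⊔ Y.1, by
    obtain ⟨C, h, h'⟩ := X.2
    obtain ⟨E, k, k'⟩ := Y.2
    refine ⟨C ⊔ E, ?_, ?_⟩
    · rw [Prod.snd_sup, h, k, IdealQuotient.mk_sup]
    · rw [Prod.fst_sup, IdealQuotient.mk_sup, h', k', IdealQuotient.mk_sup]⟩⟩

instance : Min T.Tilde :=
  ⟨fun X Y => ⟨X.1 ⊓ Y.1, by
    obtain ⟨C, h, h'⟩ := X.2
    obtain ⟨E, k, k'⟩ := Y.2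
    refine ⟨C ⊓ E, ?_, ?_⟩
    · rw [Prod.snd_inf, h, k, IdealQuotient.mk_inf]
    · rw [Prod.fst_inf, IdealQuotient.mk_inf, h', k', IdealQuotient.mk_inf]⟩⟩

instance : SDiff T.Tilde :=
  ⟨fun X Y => ⟨X.1 \ Y.1, by
    obtain ⟨C, h, h'⟩ := X.2
    obtain ⟨E, k, k'⟩ := Y.2
    refine ⟨C \ E, ?_, ?_⟩
    · rw [IdealQuotient.mk_sdiff, ← h, ← k]; rfl
    · rw [IdealQuotient.mk_sdiff, ← h', ← k']; rfl⟩⟩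

instance : Bot T.Tilde := ⟨⟨⊥, ⊥, rfl, rfl⟩⟩

instance : LE T.Tilde := ⟨fun X Y => X.1 ≤ Y.1⟩

instance : LT T.Tilde := ⟨fun X Y => X.1 < Y.1⟩

/-- `B̃` with the coordinatewise operations. -/
instance : GeneralizedBooleanAlgebra T.Tilde :=
  Function.Injective.generalizedBooleanAlgebra (fun X : T.Tilde => X.1) Subtype.val_injective
    Iff.rfl Iff.rfl (fun _ _ => rfl) (fun _ _ => rfl) rfl (fun _ _ => rfl)

/-- The element `(A, [A]_J)` of `B̃`. -/
def diag (A : B) : T.Tilde := ⟨(A, IdealQuotient.mk T.J A), A, rfl, rfl⟩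

end Tilde

/-- `(B̃, L, θ̃)` with `θ̃_α(A, [C]) = (θ_α(A), [θ_α(A)])`. -/
def tildeBDS : BooleanDynamicalSystem T.Tilde L where
  θ α X := Tilde.diag T (T.θ α X.1.1)
  map_bot α := congrArg (Tilde.diag T) (T.map_bot α)
  map_sup α X Y := congrArg (Tilde.diag T) (T.map_sup α X.1.1 Y.1.1)
  map_inf α X Y := congrArg (Tilde.diag T) (T.map_inf α X.1.1 Y.1.1)
  map_sdiff α X Y := congrArg (Tilde.diag T) (T.map_sdiff α X.1.1 Y.1.1)

/-- `Ĩ_α = {(A, [A]_J) : A ∈ I_α}`. -/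
def tildeI (α : L) : Set T.Tilde := {X | ∃ A ∈ T.I α, X = Tilde.diag T A}

/-- `(B̃, L, θ̃, Ĩ_α; B̃_reg)`. -/
def tilde : RelationData T.Tilde L where
  toBooleanDynamicalSystem := T.tildeBDS
  I := T.tildeI
  θ_mem α X := ⟨T.θ α X.1.1, T.R_subset α ⟨X.1.1, le_rfl⟩, rfl⟩
  J := T.tildeBDS.regIdeal
  J_le := le_rfl

/-- The ideal of `B̃` generated by `Ĩ_α`; since `Ĩ_α` is closed under unions, it consists of all
elements of `B̃` that are contained in an element of `Ĩ_α`. -/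
def tildeIdeal (α : L) : Order.Ideal T.Tilde where
  carrier := {X | ∃ Y ∈ T.tildeI α, X ≤ Y}
  lower' := fun _ _ h ⟨Z, hZ, h'⟩ => ⟨Z, hZ, h.trans h'⟩
  nonempty' := ⟨Tilde.diag T ⊥, _, ⟨⊥, (T.I α).bot_mem, rfl⟩, le_rfl⟩
  directed' := by
    rintro X ⟨_, ⟨A, hA, rfl⟩, hX⟩ Y ⟨_, ⟨C, hC, rfl⟩, hY⟩
    have h : Tilde.diag T A ⊔ Tilde.diag T C = Tilde.diag T (A ⊔ C) := rfl
    exact ⟨X ⊔ Y, ⟨_, ⟨A ⊔ C, Order.Ideal.sup_mem hA hC, rfl⟩, h ▸ sup_le_sup hX hY⟩,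
      le_sup_left, le_sup_right⟩

/-- The generalized Boolean dynamical system formed by `(B̃, L, θ̃)` and the ideals generated by the
sets `Ĩ_α`. -/
def tildeGBDS : GeneralizedBDS T.Tilde L where
  toBooleanDynamicalSystem := T.tildeBDS
  I := T.tildeIdeal
  R_subset := by
    rintro α X ⟨C, hC⟩
    exact ⟨_, ⟨T.θ α C.1.1, T.R_subset α ⟨C.1.1, le_rfl⟩, rfl⟩, hC⟩

end RelativeGBDS

/-! The two systems have the same representations. Let (P, S) be a representation of the relative
system. For regular R put `gap` R = P_R − ∑_α S_{α,θ_α(R)} S_{α,θ_α(R)}^*. This projection measures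
the failure of (iv) at R. It commutes with every P_A, is killed by right multiplication with every
S_{α,C} (`gap_mul_S`), and vanishes for R in J. Given (A,[C]_J), choose a regular R with A ∪ R = C ∪
R; the extension uses P_C under `gap` R and P_A off it, that is, P_A + `gap` R (P_C − P_A). This is
independent of C and R (`glue_eq_glue`) and is P_A on the diagonal.

The regular elements of B̃ are the (A,∅) with A regular (`Tilde.isRegular_iff`). There the formula
gives P_A − `gap` A, the sum of range projections, which is (iv) for B̃.

Conversely, a representation over B̃ is determined by its diagonal part (`representation_ext`):
diagonal and regular elements build all of B̃, and (iv) fixes the regular ones. Extension and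
restriction thus induce mutually inverse homomorphisms of the universal algebras. -/

namespace RelationData.Representation

variable {B : Type u} {L : Type v} [GeneralizedBooleanAlgebra B] {D : RelationData B L}
  {M : Type w} [NonUnitalCStarAlgebra M] (ρ : D.Representation M)

/-! ### Elementary identities in a representation -/

theorem star_P (A : B) : star (ρ.P A) = ρ.P A := (ρ.isStarProjection_P A).isSelfAdjoint.star_eq

theorem P_sdiff (A A' : B) : ρ.P (A \ A') = ρ.P A - ρ.P (A ⊓ A') := by
  have h := ρ.P_sup (A ⊓ A') (A \ A')
  rw [sup_inf_sdiff, inf_inf_sdiff, ρ.P_bot, sub_zero] at h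
  rw [h, add_sub_cancel_left]

theorem S_mul_P_self (α : L) (C : D.I α) : ρ.S α C * ρ.P C = ρ.S α C := by
  have h := ρ.isPartialIsometry_S α C
  rwa [mul_assoc, ρ.star_S_mul_S, inf_idem] at h

/-- By the C*-identity it suffices that (x − y)^*(x − y) = 0 for the two sides x, y; all four
products in it equal P at the common intersection. This replaces monotonicity of the sets `I α`,
which need not be ideals. -/
theorem S_mul_P_eq_S_mul_P {α : L} {C C' : D.I α} {A A' : B} (h : C.1 ⊓ A = C'.1 ⊓ A') :
    ρ.S α C * ρ.P A = ρ.S α C' * ρ.P A' := by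
  rw [← sub_eq_zero, ← CStarRing.star_mul_self_eq_zero_iff]
  have key : ∀ (E E' : D.I α) (F F' : B), E.1 ⊓ F = C.1 ⊓ A → E'.1 ⊓ F' = C.1 ⊓ A →
      ρ.P F * star (ρ.S α E) * (ρ.S α E' * ρ.P F') = ρ.P (C.1 ⊓ A) := by
    intro E E' F F' hE hE'
    rw [mul_assoc, ← mul_assoc (star _), ρ.star_S_mul_S, ← ρ.P_inf, ← ρ.P_inf]
    congr 1
    calc F ⊓ (E.1 ⊓ E'.1 ⊓ F') = (E.1 ⊓ F) ⊓ (E'.1 ⊓ F') := by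
          rw [inf_assoc E.1, ← inf_assoc F, inf_comm F]
      _ = C.1 ⊓ A := by rw [hE, hE', inf_idem]
  rw [star_sub, star_mul, star_mul, ρ.star_P, ρ.star_P, sub_mul, mul_sub, mul_sub,
    key C C A A rfl rfl, key C C' A A' rfl h.symm, key C' C A' A h.symm rfl,
    key C' C' A' A' h.symm h.symm, sub_self]

theorem S_mul_P {α : L} {C E : D.I α} {A : B} (h : C.1 ⊓ A = E.1) :
    ρ.S α C * ρ.P A = ρ.S α E := by
  rw [← ρ.S_mul_P_self α E]
  exact ρ.S_mul_P_eq_S_mul_P (by rw [h, inf_idem])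

theorem S_eq_zero {α : L} {C : D.I α} (h : C.1 = ⊥) : ρ.S α C = 0 := by
  rw [← ρ.S_mul_P_self, h, ρ.P_bot, mul_zero]

/-- The image of a representation under a star homomorphism. -/
def map {N : Type*} [NonUnitalCStarAlgebra N] (σ : D.Representation M) (f : M →⋆ₙₐ[ℂ] N) :
    D.Representation N where
  P A := f (σ.P A)
  S α C := f (σ.S α C)
  isStarProjection_P A := (σ.isStarProjection_P A).map f
  isPartialIsometry_S α C := by
    rw [← map_star, ← map_mul, ← map_mul, σ.isPartialIsometry_S]
  P_bot := by rw [σ.P_bot, map_zero]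
  P_inf A A' := by rw [σ.P_inf, map_mul]
  P_sup A A' := by rw [σ.P_sup, map_sub, map_add]
  P_mul_S A α C := by rw [← map_mul, σ.P_mul_S, map_mul]
  star_S_mul_S α C C' := by rw [← map_star, ← map_mul, σ.star_S_mul_S]
  star_S_mul_S_of_ne α α' C C' h := by
    rw [← map_star, ← map_mul, σ.star_S_mul_S_of_ne _ _ _ _ h, map_zero]
  P_eq_sum A hA := by
    rw [σ.P_eq_sum A hA, map_sum]
    simp only [map_mul, map_star]

/-! ### Range projections and the defect of relation (iv) -/

/-- The range projection of `S_{α, θ_α(A)}`. -/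
def rangeProj (α : L) (A : B) : M :=
  ρ.S α ⟨D.θ α A, D.θ_mem α A⟩ * star (ρ.S α ⟨D.θ α A, D.θ_mem α A⟩)

theorem P_mul_rangeProj (α : L) (A A' : B) :
    ρ.P A' * ρ.rangeProj α A = ρ.rangeProj α (A ⊓ A') := by
  let E : D.I α := ⟨D.θ α (A ⊓ A'), D.θ_mem α _⟩
  let F : D.I α := ⟨D.θ α A, D.θ_mem α _⟩
  have h1 : ρ.S α F * ρ.P (D.θ α A') = ρ.S α E := ρ.S_mul_P (D.map_inf α A A').symm
  have h2 : ρ.S α F * ρ.P E = ρ.S α E := ρ.S_mul_P (by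
    change D.θ α A ⊓ D.θ α (A ⊓ A') = D.θ α (A ⊓ A')
    rw [← D.map_inf, inf_left_idem])
  change ρ.P A' * (ρ.S α F * star (ρ.S α F)) = ρ.S α E * star (ρ.S α E)
  rw [← mul_assoc, ρ.P_mul_S, h1]
  -- The left side is S_E S_F^*. Since S_E = S_E P_E and P_E S_F^* = S_E^*, it equals S_E S_E^*.
  conv_lhs => rw [← ρ.S_mul_P_self, mul_assoc]
  conv_rhs => rw [← h2, star_mul, ρ.star_P, ← mul_assoc, h2]
  rw [← mul_assoc]

/-- The defect `P_R - ∑ S_{α, θ_α(R)} S_{α, θ_α(R)}^*` of the relation (iv) at a regular `R`. -/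
noncomputable def gap (R : B) : M := ρ.P R - ∑ᶠ α, ρ.rangeProj α R

variable {ρ}

/-- Labels outside Δ_A contribute zero, so sums belonging to different elements can be taken over
one common finite set. -/
theorem finsum_rangeProj {A : B} {F : Finset L} (h : D.Δ A ⊆ F) :
    ∑ᶠ α, ρ.rangeProj α A = ∑ α ∈ F, ρ.rangeProj α A := by
  refine finsum_eq_sum_of_support_subset _ fun α hα => h fun h0 => hα ?_
  change ρ.rangeProj α A = 0
  rw [rangeProj, ρ.S_eq_zero h0, zero_mul]

theorem gap_eq {R : B} (hR : D.IsRegular R) :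
    ρ.gap R = ρ.P R - ∑ α ∈ hR.finite_Δ.toFinset, ρ.rangeProj α R := by
  rw [gap, finsum_rangeProj (Set.Finite.coe_toFinset _).symm.subset]

theorem star_gap {R : B} (hR : D.IsRegular R) : star (ρ.gap R) = ρ.gap R := by
  simp [gap_eq hR, ρ.star_P, rangeProj]

theorem P_mul_gap {R : B} (hR : D.IsRegular R) (A : B) : ρ.P A * ρ.gap R = ρ.gap (R ⊓ A) := by
  have h : D.Δ (R ⊓ A) ⊆ hR.finite_Δ.toFinset := by
    rw [Set.Finite.coe_toFinset]
    intro α hα h0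
    apply hα
    rw [D.map_inf, h0, bot_inf_eq]
  rw [gap_eq hR, gap, finsum_rangeProj h, mul_sub, Finset.mul_sum, ← ρ.P_inf, inf_comm]
  simp only [P_mul_rangeProj]

theorem gap_mul_P {R : B} (hR : D.IsRegular R) (A : B) : ρ.gap R * ρ.P A = ρ.gap (R ⊓ A) := by
  rw [← star_gap (hR.mono inf_le_left), ← P_mul_gap hR, star_mul, star_gap hR, ρ.star_P]

/-- Against S_{α,C} only the range projection with label α survives, and it yields S_{α,C}
P_{θ_α(R)} = P_R S_{α,C}, which cancels the first term of the gap. -/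
theorem gap_mul_S {R : B} (hR : D.IsRegular R) (α : L) (C : D.I α) :
    ρ.gap R * ρ.S α C = 0 := by
  let E : D.I α := ⟨D.θ α R, D.θ_mem α R⟩
  have key : ρ.rangeProj α R * ρ.S α C = ρ.S α C * ρ.P (D.θ α R) := by
    rw [rangeProj, mul_assoc, ρ.star_S_mul_S]
    refine ρ.S_mul_P_eq_S_mul_P ?_
    change D.θ α R ⊓ (D.θ α R ⊓ C.1) = C.1 ⊓ D.θ α R
    rw [inf_left_idem, inf_comm]
  classical
  -- Inserting α into the index set avoids a case distinction on whether α lies in Δ_R.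
  rw [gap, finsum_rangeProj (F := insert α hR.finite_Δ.toFinset) (by simp), sub_mul,
    Finset.sum_mul, Finset.sum_eq_single α, key, ρ.P_mul_S, sub_self]
  · intro β _ hβ
    rw [rangeProj, mul_assoc, ρ.star_S_mul_S_of_ne _ _ _ _ hβ, mul_zero]
  · intro h
    exact absurd (Finset.mem_insert_self _ _) h

theorem gap_mul_gap {R : B} (hR : D.IsRegular R) : ρ.gap R * ρ.gap R = ρ.gap R := by
  -- Only the right factor is expanded: the left one kills all range projections and is fixed by
  -- P_R.
  conv_lhs => rhs; rw [gap_eq hR]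
  rw [mul_sub, gap_mul_P hR, inf_idem, Finset.mul_sum, Finset.sum_eq_zero, sub_zero]
  intro α _
  rw [rangeProj, ← mul_assoc, gap_mul_S hR, zero_mul]

theorem gap_eq_zero {R : B} (hR : R ∈ D.J) : ρ.gap R = 0 := by
  rw [gap_eq (D.J_le hR), ρ.P_eq_sum R hR]
  exact sub_self _

end RelationData.Representation

/-! ### Gluing two projections along a gap -/

namespace RelationData.Representation

variable {B : Type u} {L : Type v} [GeneralizedBooleanAlgebra B] {D : RelationData B L}
  {M : Type w} [NonUnitalCStarAlgebra M] (ρ : D.Representation M)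

/-- The value at `(A, [C]_J)` of the extension of `P` to `B̃`, computed by means of a regular `R` with
`A ∪ R = C ∪ R`. -/
noncomputable def glue (A C R : B) : M := ρ.P A + ρ.gap R * (ρ.P C - ρ.P A)

variable {ρ}

/-- As A and C agree off R, P_C − P_A is fixed by P_R, and `gap` R = `gap` R' P_R. -/
theorem glue_mono {A C R R' : B} (h : A ⊔ R = C ⊔ R) (hR' : D.IsRegular R') (hle : R ≤ R') :
    ρ.glue A C R = ρ.glue A C R' := by
  have h1 : ρ.gap R = ρ.gap R' * ρ.P R := by rw [gap_mul_P hR', inf_eq_right.2 hle]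
  have h2 : ∀ A, ρ.P R * ρ.P A = ρ.P A + ρ.P R - ρ.P (A ⊔ R) := fun A => by
    rw [ρ.P_sup, ← ρ.P_inf, inf_comm]; abel
  rw [glue, glue, h1, mul_assoc, mul_sub (ρ.P R), h2, h2, h]
  congr 2
  abel

/-- For K in J one has `gap` R P_K = `gap` (R ∩ K) = 0, so under the gap C may be enlarged by K.
Hence only the class [C]_J matters. -/
theorem gap_mul_P_eq {R C C' : B} (hR : D.IsRegular R)
    (h : IdealQuotient.mk D.J C = IdealQuotient.mk D.J C') :
    ρ.gap R * ρ.P C = ρ.gap R * ρ.P C' := by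
  obtain ⟨K, hK, h⟩ := idealRel_iff.1 (IdealQuotient.mk_eq_mk.1 h)
  have h0 : ρ.gap R * ρ.P K = 0 := by
    rw [gap_mul_P hR, gap_eq_zero (D.J.lower inf_le_right hK)]
  have key : ∀ C, ρ.gap R * ρ.P C = ρ.gap R * ρ.P (C ⊔ K) := fun C => by
    rw [ρ.P_sup, inf_comm, ρ.P_inf, mul_sub, mul_add, ← mul_assoc, h0, zero_mul, add_zero, sub_zero]
  rw [key, key C', h]

theorem glue_eq_glue {A C C' R R' : B} (hR : D.IsRegular R) (hR' : D.IsRegular R')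
    (h : A ⊔ R = C ⊔ R) (h' : A ⊔ R' = C' ⊔ R')
    (hC : IdealQuotient.mk D.J C = IdealQuotient.mk D.J C') :
    ρ.glue A C R = ρ.glue A C' R' := by
  have hs := hR.sup hR'
  rw [glue_mono h hs le_sup_left, glue_mono h' hs le_sup_right, glue, glue, mul_sub, mul_sub,
    gap_mul_P_eq hs hC]

theorem glue_self (A R : B) : ρ.glue A A R = ρ.P A := by
  rw [glue, sub_self, mul_zero, add_zero]

theorem gap_mul_P_comm {R : B} (hR : D.IsRegular R) (A : B) :
    ρ.gap R * ρ.P A = ρ.P A * ρ.gap R := by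
  rw [gap_mul_P hR, P_mul_gap hR]

theorem star_glue {A C R : B} (hR : D.IsRegular R) : star (ρ.glue A C R) = ρ.glue A C R := by
  rw [glue, star_add, star_mul, star_sub, ρ.star_P, ρ.star_P, star_gap hR, mul_sub, sub_mul,
    gap_mul_P_comm hR, gap_mul_P_comm hR]

/-- The gap is a projection commuting with all P, so the glued element is P_C on the gap and P_A on
its complement; each piece is multiplicative and the cross terms vanish. -/
theorem glue_inf {A A' C C' R : B} (hR : D.IsRegular R) :
    ρ.glue (A ⊓ A') (C ⊓ C') R = ρ.glue A C R * ρ.glue A' C' R := by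
  have h : ∀ E E' : B, ρ.gap R * ρ.P E * (ρ.gap R * ρ.P E') = ρ.gap R * (ρ.P E * ρ.P E') :=
    fun E E' => by
      rw [gap_mul_P_comm hR, mul_assoc, ← mul_assoc (ρ.gap R), gap_mul_gap hR, ← mul_assoc,
        ← gap_mul_P_comm hR, mul_assoc]
  have h' : ∀ E E' : B, ρ.P E * (ρ.gap R * ρ.P E') = ρ.gap R * (ρ.P E * ρ.P E') :=
    fun E E' => by rw [← mul_assoc, ← gap_mul_P_comm hR, mul_assoc]
  simp only [glue, ρ.P_inf, mul_add, add_mul, mul_sub, sub_mul, h, h', mul_assoc (ρ.gap R) _ (ρ.P _)]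
  abel

theorem glue_sup {A A' C C' R : B} :
    ρ.glue (A ⊔ A') (C ⊔ C') R =
      ρ.glue A C R + ρ.glue A' C' R - ρ.glue (A ⊓ A') (C ⊓ C') R := by
  simp only [glue, ρ.P_sup, mul_add, mul_sub]
  abel

theorem glue_mul_S {A C R : B} (hR : D.IsRegular R) (α : L) (E : D.I α) :
    ρ.glue A C R * ρ.S α E = ρ.S α E * ρ.P (D.θ α A) := by
  rw [glue, mul_sub, gap_mul_P_comm hR, gap_mul_P_comm hR, add_mul, sub_mul, mul_assoc _ (ρ.gap R),
    mul_assoc _ (ρ.gap R), gap_mul_S hR, mul_zero, mul_zero, sub_zero, add_zero, ρ.P_mul_S]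

theorem glue_bot {A : B} (hA : D.IsRegular A) :
    ρ.glue A ⊥ A = ∑ α ∈ hA.finite_Δ.toFinset, ρ.rangeProj α A := by
  rw [glue, ρ.P_bot, zero_sub, mul_neg, gap_mul_P hA, inf_idem, gap_eq hA, neg_sub,
    add_sub_cancel]

end RelationData.Representation

/-! ### Regular elements and generators of B̃ -/

namespace RelativeGBDS

open RelationData

variable {B : Type u} {L : Type v} [GeneralizedBooleanAlgebra B] (T : RelativeGBDS B L)

namespace Tilde

variable {T}

theorem exists_glueData (X : T.Tilde) : ∃ C R : B, T.IsRegular R ∧ X.1.1 ⊔ R = C ⊔ R ∧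
    X.1.2 = IdealQuotient.mk T.J C := by
  obtain ⟨C, h, h'⟩ := X.2
  obtain ⟨R, hR, h'⟩ := idealRel_iff.1 (IdealQuotient.mk_eq_mk.1 h')
  exact ⟨C, R, hR, h', h⟩

theorem diag_eq_bot {A : B} : diag T A = ⊥ ↔ A = ⊥ :=
  ⟨fun h => congrArg (fun X : T.Tilde => X.1.1) h, fun h => h ▸ rfl⟩

theorem Δ_eq (X : T.Tilde) : T.tildeBDS.Δ X = T.Δ X.1.1 :=
  Set.ext fun _ => not_congr diag_eq_bot

/-- The regular elements of `B̃` are the pairs `(A, ∅)` with `A` regular. -/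
theorem isRegular_iff {X : T.Tilde} : T.tildeBDS.IsRegular X ↔ T.IsRegular X.1.1 ∧ X.1.2 = ⊥ := by
  constructor
  · intro hX
    obtain ⟨C, R, hR, h, h'⟩ := X.exists_glueData
    have hA : T.IsRegular X.1.1 := by
      intro A hA hA0
      -- A lifts to the element (A,[C ∩ A]_J) below X, which has the same Δ as A.
      have hY : IdealQuotient.mk T.regIdeal A = IdealQuotient.mk T.regIdeal (C ⊓ A) := by
        conv_lhs => rw [← inf_eq_right.2 hA, IdealQuotient.mk_inf,
          IdealQuotient.mk_eq_mk.2 (idealRel_iff.2 ⟨R, hR, h⟩), ← IdealQuotient.mk_inf]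
      let Y : T.Tilde := ⟨(A, IdealQuotient.mk T.J (C ⊓ A)), _, rfl, hY⟩
      have hle : Y ≤ X := ⟨hA, by
        change IdealQuotient.mk T.J (C ⊓ A) ≤ X.1.2
        rw [h', IdealQuotient.mk_inf]
        exact inf_le_left⟩
      have := hX Y hle fun h0 => hA0 (congrArg (fun X : T.Tilde => X.1.1) h0)
      rwa [Δ_eq] at this
    have hC : T.IsRegular C :=
      (hA.sup hR).mono (h ▸ le_sup_left)
    -- Since C is regular, (∅,[C]_J) lies in B̃ and below X. Its Δ is empty, so regularity of X
    -- forces it to be zero.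
    have hY : IdealQuotient.mk T.regIdeal ⊥ = IdealQuotient.mk T.regIdeal C :=
      IdealQuotient.mk_eq_mk.2 (idealRel_iff.2 ⟨C, hC, by rw [bot_sup_eq, sup_idem]⟩)
    let Y : T.Tilde := ⟨(⊥, X.1.2), C, h', hY⟩
    refine ⟨hA, by_contra fun hne => ?_⟩
    obtain ⟨⟨α, hα⟩, -⟩ := hX Y ⟨bot_le, le_rfl⟩ fun h0 =>
      hne (congrArg (fun X : T.Tilde => X.1.2) h0)
    rw [Δ_eq] at hα
    exact hα (T.map_bot α)
  · rintro ⟨hA, h0⟩ Y hY hne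
    rw [Δ_eq]
    refine hA _ hY.1 fun hA0 => hne (Subtype.ext (Prod.ext hA0 ?_))
    exact le_bot_iff.1 (h0 ▸ hY.2)

end Tilde

/-- `(B̃, L, θ̃)` with sets `I α` that contain `Ĩ_α`, and the ideal `B̃_reg`. -/
def tildeWith (I : L → Set T.Tilde) (hI : ∀ α, T.tildeI α ⊆ I α) : RelationData T.Tilde L where
  toBooleanDynamicalSystem := T.tildeBDS
  I := I
  θ_mem α X := hI α ⟨T.θ α X.1.1, T.R_subset α ⟨X.1.1, le_rfl⟩, rfl⟩
  J := T.tildeBDS.regIdeal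
  J_le := le_rfl

variable {T} {I : L → Set T.Tilde} {hI : ∀ α, T.tildeI α ⊆ I α}
  {M : Type w} [NonUnitalCStarAlgebra M]

/-- The element `(A, [A]_J)` of `Ĩ_α`. -/
def diagI (hI : ∀ α, T.tildeI α ⊆ I α) (α : L) (A : T.toRelationData.I α) :
    (T.tildeWith I hI).I α :=
  ⟨Tilde.diag T A.1, hI α ⟨A.1, A.2, rfl⟩⟩

/-- The class [A]_J vanishes for A in J. Through this, (iv) on the regular ideal of B̃ restricts to
(iv) on J. -/
theorem isRegular_diag {A : B} (hA : A ∈ T.J) : T.tildeBDS.IsRegular (Tilde.diag T A) :=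
  Tilde.isRegular_iff.2 ⟨T.J_le hA, (IdealQuotient.mk_eq_mk.2
    (idealRel_iff.2 ⟨A, hA, by rw [bot_sup_eq, sup_idem]⟩) : IdealQuotient.mk T.J A = _)⟩

/-- The restriction of a representation along `A ↦ (A, [A]_J)`. -/
def restrict (σ : (T.tildeWith I hI).Representation M) : T.toRelationData.Representation M where
  P A := σ.P (Tilde.diag T A)
  S α C := σ.S α (diagI hI α C)
  isStarProjection_P A := σ.isStarProjection_P _
  isPartialIsometry_S α C := σ.isPartialIsometry_S α _
  P_bot := σ.P_bot
  P_inf A A' := σ.P_inf (Tilde.diag T A) (Tilde.diag T A')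
  P_sup A A' := σ.P_sup (Tilde.diag T A) (Tilde.diag T A')
  P_mul_S A α C := σ.P_mul_S _ α _
  star_S_mul_S α C C' := σ.star_S_mul_S α _ _
  star_S_mul_S_of_ne α α' C C' h := σ.star_S_mul_S_of_ne α α' _ _ h
  P_eq_sum A hA := by
    refine (σ.P_eq_sum (Tilde.diag T A) (isRegular_diag hA)).trans ?_
    refine Finset.sum_congr ?_ fun α _ => rfl
    ext α
    rw [Set.Finite.mem_toFinset, Set.Finite.mem_toFinset]
    exact Set.ext_iff.1 (Tilde.Δ_eq (Tilde.diag T A)) α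

theorem Tilde.exists_isRegular_eq {R : B} (hR : T.IsRegular R) :
    ∃ X : T.Tilde, T.tildeBDS.IsRegular X ∧ X.1 = (R, ⊥) := by
  have h : IdealQuotient.mk T.regIdeal R = IdealQuotient.mk T.regIdeal ⊥ :=
    IdealQuotient.mk_eq_mk.2 (idealRel_iff.2 ⟨R, hR, by rw [bot_sup_eq, sup_idem]⟩)
  exact ⟨⟨(R, ⊥), ⊥, rfl, h⟩, isRegular_iff.2 ⟨hR, rfl⟩, rfl⟩

/-- Every element of `B̃` is built from diagonal and regular elements. -/
theorem Tilde.induction {p : T.Tilde → Prop} (diag : ∀ A, p (Tilde.diag T A))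
    (regular : ∀ X, T.tildeBDS.IsRegular X → p X) (sup : ∀ X Y, p X → p Y → p (X ⊔ Y))
    (sdiff : ∀ X Y, p X → p Y → p (X \ Y)) (X : T.Tilde) : p X := by
  obtain ⟨C, R, hR, h, h'⟩ := X.exists_glueData
  obtain ⟨Y, hY, hYR⟩ := Tilde.exists_isRegular_eq hR
  obtain ⟨Z, hZ, hZA⟩ : ∃ Z : T.Tilde, T.tildeBDS.IsRegular Z ∧ Z.1 = (X.1.1 ⊓ R, ⊥) :=
    Tilde.exists_isRegular_eq (hR.mono inf_le_right)
  -- With X = (A,[C]_J), Y = (R,∅) and Z = (A ∩ R,∅): the first coordinate is (C \ R) ∪ (A ∩ R),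
  -- where C \ R = A \ R, and Y and Z leave the second coordinate alone.
  have hX : X = (Tilde.diag T C \ Y) ⊔ Z := by
    refine Subtype.ext (Prod.ext ?_ ?_)
    · change X.1.1 = C \ Y.1.1 ⊔ Z.1.1
      have hs : C \ R = X.1.1 \ R := by rw [← sup_sdiff_right_self, ← h, sup_sdiff_right_self]
      rw [hYR, hZA, hs, sup_comm, sup_inf_sdiff]
    · change X.1.2 = IdealQuotient.mk T.J C \ Y.1.2 ⊔ Z.1.2
      rw [hYR, hZA, h']
      exact (sdiff_bot.symm.trans (sup_bot_eq _).symm)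
  rw [hX]
  exact sup _ _ (sdiff _ _ (diag C) (regular Y hY)) (regular Z hZ)

end RelativeGBDS

/-! ### Uniqueness and existence of extensions, and the isomorphism -/

namespace RelativeGBDS

open RelationData RelationData.Representation

variable {B : Type u} {L : Type v} [GeneralizedBooleanAlgebra B] {T : RelativeGBDS B L}
  {I : L → Set T.Tilde} {hI : ∀ α, T.tildeI α ⊆ I α} {M : Type w} [NonUnitalCStarAlgebra M]

/-- All values of θ̃ are diagonal, so (iv) expresses P at regular elements by diagonal S. For X
below the diagonal element of A, S at X is S at that element times P_X. -/
theorem representation_ext (hI' : ∀ α, I α ⊆ T.tildeIdeal α)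
    {σ σ' : (T.tildeWith I hI).Representation M}
    (hP : ∀ A, σ.P (Tilde.diag T A) = σ'.P (Tilde.diag T A))
    (hS : ∀ α A, σ.S α (diagI hI α A) = σ'.S α (diagI hI α A)) :
    (∀ X, σ.P X = σ'.P X) ∧ ∀ α X, σ.S α X = σ'.S α X := by
  have hinf : ∀ X Y, σ.P X = σ'.P X → σ.P Y = σ'.P Y → σ.P (X ⊓ Y) = σ'.P (X ⊓ Y) :=
    fun X Y hX hY => by rw [σ.P_inf, σ'.P_inf, hX, hY]
  have h : ∀ X, σ.P X = σ'.P X := by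
    refine Tilde.induction hP (fun X hX => ?_) (fun X Y hX hY => ?_) fun X Y hX hY => ?_
    · rw [σ.P_eq_sum X hX, σ'.P_eq_sum X hX]
      refine Finset.sum_congr rfl fun α _ => ?_
      have := hS α ⟨T.θ α X.1.1, T.R_subset α ⟨X.1.1, le_rfl⟩⟩
      exact congrArg (fun x => x * star x) this
    · rw [σ.P_sup, σ'.P_sup, hinf X Y hX hY, hX, hY]
    · rw [σ.P_sdiff, σ'.P_sdiff, hinf X Y hX hY, hX]
  refine ⟨h, fun α X => ?_⟩
  obtain ⟨_, ⟨A, hA, rfl⟩, hle⟩ := hI' α X.2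
  have hX : (diagI hI α ⟨A, hA⟩).1 ⊓ X.1 = X.1 := inf_eq_right.2 hle
  rw [← σ.S_mul_P hX, ← σ'.S_mul_P hX, hS, h]

/-- The extension of `P` to `B̃`. -/
noncomputable def tildeP (ρ : T.toRelationData.Representation M) (X : T.Tilde) : M :=
  ρ.glue X.1.1 X.exists_glueData.choose X.exists_glueData.choose_spec.choose

variable (ρ : T.toRelationData.Representation M)

/-- Frees later computations from the chosen C and R, so that two elements can share one R. -/
theorem tildeP_eq {X : T.Tilde} {C R : B} (hR : T.IsRegular R) (h : X.1.1 ⊔ R = C ⊔ R)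
    (h' : X.1.2 = IdealQuotient.mk T.J C) : tildeP ρ X = ρ.glue X.1.1 C R := by
  obtain ⟨hR₀, h₀, h₀'⟩ := X.exists_glueData.choose_spec.choose_spec
  exact glue_eq_glue hR₀ hR h₀ h (h₀'.symm.trans h')

theorem tildeP_diag (A : B) : tildeP ρ (Tilde.diag T A) = ρ.P A :=
  (tildeP_eq ρ (C := A) BooleanDynamicalSystem.isRegular_bot rfl rfl).trans (glue_self A ⊥)

theorem tildeP_inf_and_sup (X Y : T.Tilde) :
    tildeP ρ (X ⊓ Y) = tildeP ρ X * tildeP ρ Y ∧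
      tildeP ρ (X ⊔ Y) = tildeP ρ X + tildeP ρ Y - tildeP ρ (X ⊓ Y) := by
  obtain ⟨C, R, hR, h, h'⟩ := X.exists_glueData
  obtain ⟨C', R', hR', k, k'⟩ := Y.exists_glueData
  have hs := hR.sup hR'
  replace h : X.1.1 ⊔ (R ⊔ R') = C ⊔ (R ⊔ R') := by rw [← sup_assoc, h, sup_assoc]
  replace k : Y.1.1 ⊔ (R ⊔ R') = C' ⊔ (R ⊔ R') := by
    rw [sup_comm R, ← sup_assoc, k, sup_assoc]
  have hinf : tildeP ρ (X ⊓ Y) = ρ.glue (X.1.1 ⊓ Y.1.1) (C ⊓ C') (R ⊔ R') :=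
    tildeP_eq ρ (X := X ⊓ Y) hs
      (by change X.1.1 ⊓ Y.1.1 ⊔ _ = _; rw [sup_inf_right, sup_inf_right, h, k])
      (by change X.1.2 ⊓ Y.1.2 = _; rw [h', k', IdealQuotient.mk_inf])
  have hsup : tildeP ρ (X ⊔ Y) = ρ.glue (X.1.1 ⊔ Y.1.1) (C ⊔ C') (R ⊔ R') :=
    tildeP_eq ρ (X := X ⊔ Y) hs
      (by
        change X.1.1 ⊔ Y.1.1 ⊔ _ = _
        rw [← sup_idem (R ⊔ R'), sup_sup_sup_comm, h, k, sup_sup_sup_comm])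
      (by change X.1.2 ⊔ Y.1.2 = _; rw [h', k', IdealQuotient.mk_sup])
  rw [hinf, hsup, tildeP_eq ρ hs h h', tildeP_eq ρ hs k k']
  exact ⟨glue_inf hs, glue_sup⟩

theorem star_tildeP (X : T.Tilde) : star (tildeP ρ X) = tildeP ρ X := by
  obtain ⟨C, R, hR, h, h'⟩ := X.exists_glueData
  rw [tildeP_eq ρ hR h h', star_glue hR]

theorem tildeP_mul_S (X : T.Tilde) (α : L) (E : T.toRelationData.I α) :
    tildeP ρ X * ρ.S α E = ρ.S α E * ρ.P (T.θ α X.1.1) := by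
  obtain ⟨C, R, hR, h, h'⟩ := X.exists_glueData
  rw [tildeP_eq ρ hR h h']
  exact glue_mul_S hR α E

theorem tildeP_of_isRegular {X : T.Tilde} (hX : T.tildeBDS.IsRegular X) :
    tildeP ρ X = ∑ α ∈ hX.finite_Δ.toFinset, ρ.rangeProj α X.1.1 := by
  obtain ⟨hA, h0⟩ := Tilde.isRegular_iff.1 hX
  rw [tildeP_eq ρ (C := ⊥) hA (by rw [sup_idem, bot_sup_eq]) h0]
  refine (glue_bot hA).trans (Finset.sum_congr ?_ fun _ _ => rfl)
  ext α
  rw [Set.Finite.mem_toFinset, Set.Finite.mem_toFinset, Tilde.Δ_eq]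
  rfl

/-- Every representation of `(B, L, θ, I_α; J)` extends to `B̃`. -/
theorem exists_extension (hI' : ∀ α, I α ⊆ T.tildeIdeal α) :
    ∃ σ : (T.tildeWith I hI).Representation M, (∀ A, σ.P (Tilde.diag T A) = ρ.P A) ∧
      ∀ α A, σ.S α (diagI hI α A) = ρ.S α A := by
  have hX : ∀ α (X : (T.tildeWith I hI).I α), ∃ A : T.toRelationData.I α,
      X.1 ≤ Tilde.diag T A.1 := by
    intro α X
    obtain ⟨_, ⟨A, hA, rfl⟩, hle⟩ := hI' α X.2
    exact ⟨⟨A, hA⟩, hle⟩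
  -- The extension of S at X will be S_{α,A} P̃_X, where A is any element of I_α whose diagonal
  -- element contains X.
  choose A hA using hX
  have hinf : ∀ X Y : T.Tilde, tildeP ρ X * tildeP ρ Y = tildeP ρ (X ⊓ Y) :=
    fun X Y => (tildeP_inf_and_sup ρ X Y).1.symm
  have hstar : ∀ α (X Y : (T.tildeWith I hI).I α),
      star (ρ.S α (A α X) * tildeP ρ X.1) * (ρ.S α (A α Y) * tildeP ρ Y.1) =
        tildeP ρ (X.1 ⊓ Y.1) := by
    intro α X Y
    rw [star_mul, star_tildeP, mul_assoc, ← mul_assoc (star _), ρ.star_S_mul_S, ρ.P_inf,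
      ← tildeP_diag, ← tildeP_diag, mul_assoc, hinf, inf_eq_right.2 (hA α Y), ← mul_assoc, hinf,
      inf_eq_left.2 (hA α X), hinf]
  -- The element chosen for the diagonal of C may be larger than C; multiplying by P_C cuts it back.
  have hdiag : ∀ α C, ρ.S α (A α (diagI hI α C)) * tildeP ρ (diagI hI α C).1 = ρ.S α C := by
    intro α C
    rw [diagI, tildeP_diag]
    exact ρ.S_mul_P (inf_eq_right.2 (hA α (diagI hI α C)).1)
  refine ⟨
    { P := tildeP ρ
      S := fun α X => ρ.S α (A α X) * tildeP ρ X.1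
      isStarProjection_P := fun X =>
        ⟨(hinf X X).trans (by rw [inf_idem]), star_tildeP ρ X⟩
      isPartialIsometry_S := fun α X => by
        rw [mul_assoc, hstar, mul_assoc, hinf, inf_idem, inf_idem]
      P_bot := (tildeP_diag ρ ⊥).trans ρ.P_bot
      P_inf := fun X Y => (tildeP_inf_and_sup ρ X Y).1
      P_sup := fun X Y => (tildeP_inf_and_sup ρ X Y).2
      P_mul_S := fun X α Y => by
        have h : tildeP ρ ((T.tildeWith I hI).θ α X) = ρ.P (T.θ α X.1.1) := tildeP_diag ρ _
        rw [← mul_assoc, tildeP_mul_S, mul_assoc, mul_assoc, ← h, hinf, hinf, inf_comm]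
      star_S_mul_S := hstar
      star_S_mul_S_of_ne := fun α β X Y hne => by
        rw [star_mul, mul_assoc, ← mul_assoc (star (ρ.S α _)),
          ρ.star_S_mul_S_of_ne α β _ _ hne, zero_mul, mul_zero]
      P_eq_sum := fun X hX => by
        refine (tildeP_of_isRegular ρ hX).trans (Finset.sum_congr rfl fun α _ => ?_)
        exact congrArg (fun x => x * star x)
          (hdiag α ⟨T.θ α X.1.1, T.R_subset α ⟨X.1.1, le_rfl⟩⟩).symm }, tildeP_diag ρ, hdiag⟩

/-- Allowing any sets between Ĩ_α and the ideal it generates covers both claims at once. -/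
theorem exists_starAlgEquiv (hI : ∀ α, T.tildeI α ⊆ I α) (hI' : ∀ α, I α ⊆ T.tildeIdeal α) :
    ∃ φ : T.CStar ≃⋆ₐ[ℂ] (T.tildeWith I hI).CStar,
      (∀ A : B, φ (RelationData.CStar.p T.toRelationData A) =
        RelationData.CStar.p (T.tildeWith I hI) (Tilde.diag T A)) ∧
      ∀ (α : L) (A : T.toRelationData.I α), φ (RelationData.CStar.s T.toRelationData α A) =
          RelationData.CStar.s (T.tildeWith I hI) α (diagI hI α A) := by
  let U := CStar.universalRep (D := T.toRelationData)
  let V := CStar.universalRep (D := T.tildeWith I hI)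
  obtain ⟨φ, ⟨hφP, hφS⟩, -⟩ := CStar.existsUnique_lift (restrict V)
  obtain ⟨σ, hσP, hσS⟩ := exists_extension (hI := hI) U hI'
  obtain ⟨ψ, ⟨hψP, hψS⟩, -⟩ := CStar.existsUnique_lift σ
  have hl : ψ.comp φ = NonUnitalStarAlgHom.id ℂ _ := by
    refine (CStar.existsUnique_lift U).unique ⟨fun A => ?_, fun α A => ?_⟩
      ⟨fun A => rfl, fun α A => rfl⟩
    · exact (congrArg ψ (hφP A)).trans ((hψP _).trans (hσP A))
    · exact (congrArg ψ (hφS α A)).trans ((hψS α _).trans (hσS α A))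
  have hr : φ.comp ψ = NonUnitalStarAlgHom.id ℂ _ := by
    -- Here the generators also sit at non-diagonal elements, so agreement on the diagonal has to be
    -- propagated to all of B̃.
    have h := representation_ext hI' (σ := σ.map φ) (σ' := V)
      (fun A => (congrArg φ (hσP A)).trans (hφP A))
      (fun α A => (congrArg φ (hσS α A)).trans (hφS α A))
    refine (CStar.existsUnique_lift V).unique ⟨fun X => ?_, fun α X => ?_⟩
      ⟨fun X => rfl, fun α X => rfl⟩
    · exact (congrArg φ (hψP X)).trans (h.1 X)
    · exact (congrArg φ (hψS α X)).trans (h.2 α X)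
  exact ⟨StarAlgEquiv.ofBijective φ (Function.bijective_iff_has_inverse.2
    ⟨ψ, fun x => DFunLike.congr_fun hl x, fun x => DFunLike.congr_fun hr x⟩), hφP, hφS⟩

end RelativeGBDS

theorem mainTheorem9 {B : Type u} {L : Type v} [GeneralizedBooleanAlgebra B]
    (T : RelativeGBDS B L) :
    (∃ φ : T.CStar ≃⋆ₐ[ℂ] T.tilde.CStar,
      (∀ A : B, φ (RelationData.CStar.p T.toRelationData A) =
        RelationData.CStar.p T.tilde (RelativeGBDS.Tilde.diag T A)) ∧
      (∀ (α : L) (A : B) (hA : A ∈ T.I α),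
        φ (RelationData.CStar.s T.toRelationData α ⟨A, hA⟩) =
          RelationData.CStar.s T.tilde α ⟨RelativeGBDS.Tilde.diag T A, ⟨A, hA, rfl⟩⟩)) ∧
    (∃ φ : T.CStar ≃⋆ₐ[ℂ] T.tildeGBDS.CStar,
      (∀ A : B, φ (RelationData.CStar.p T.toRelationData A) =
        RelationData.CStar.p T.tildeGBDS.toRelative.toRelationData
          (RelativeGBDS.Tilde.diag T A)) ∧
      (∀ (α : L) (A : B) (hA : A ∈ T.I α),
        φ (RelationData.CStar.s T.toRelationData α ⟨A, hA⟩) =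
          RelationData.CStar.s T.tildeGBDS.toRelative.toRelationData α
            ⟨RelativeGBDS.Tilde.diag T A, ⟨_, ⟨A, hA, rfl⟩, le_rfl⟩⟩)) := by
  constructor
  -- Both target systems are by definition instances of `tildeWith`, at the two extreme choices of
  -- I.
  · obtain ⟨φ, hp, hs⟩ := T.exists_starAlgEquiv (I := T.tildeI) (fun _ => subset_rfl)
      fun α X hX => ⟨X, hX, le_rfl⟩
    exact ⟨φ, hp, fun α A hA => hs α ⟨A, hA⟩⟩
  · obtain ⟨φ, hp, hs⟩ := T.exists_starAlgEquiv (I := fun α => T.tildeIdeal α)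
      (fun α X hX => ⟨X, hX, le_rfl⟩) fun _ => subset_rfl
    exact ⟨φ, hp, fun α A hA => hs α ⟨A, hA⟩⟩
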